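/- **Setting.** $\lambda\in\mathbb N$ is a security parameter. A function $f:\mathbb N\to\mathbb R_{\ge 0}$ is *negligible* if it is eventually smaller than $1/p(\lambda)$ for every positive polynomial $p$. For every $\lambda$ let $\mathbb U_\lambda\subset[0,1]$ be a finite value domain with $0\in\mathbb U_\lambda$, and let $\mathsf{tick}(\mathbb U_\lambda)$ be the largest distance between two adjacent points of $\mathbb U_\lambda$. Buyers have identities; strategic players can create fake identities, of which there are super-polynomially many in $\lambda$. A *platform-assisted auction* $\Pi_\lambda$ for $k$ identical items is a synchronous multi-round protocol of probabilistic interactive machines between a platform, a seller and a finite set of unit-demand buyers (each with a true value in $\mathbb U_\lambda$ as its input), using private channels between the platform and each other player and a broadcast channel. At the end the platform sends each buyer $i$ either $\bot$ or an outcome $(x_i,p_i)$ (number of items, payment $p_i\ge 0$), and the seller either $\bot$ or $(t,\mu_S)$ (number of items sold $t\le k$, revenue $\mu_S\ge 0$); then everybody accepts or rejects. The following is required. *Correctness*: if the platform is honest, all honest players agree on whether to accept; if everybody is honest, everybody accepts. *Individual rationality*: an honest buyer with value $v_i$ that accepts has $x_i\in\{0,1\}$ and $x_iv_i-p_i\ge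 0$. *Consistency and budget feasibility*: an honest platform that accepts has $t=\sum_i x_i$ and $\mu_S\le\sum_i p_i$; a strategic platform must satisfy $t\ge\sum_i x_i$ over honest buyers $i$. *Weak symmetry*: the honest outcome is distributed as if the bids were first sorted by value (ties broken by a possibly randomized rule that may depend on identities), after which a randomized algorithm that sees only the sorted values assigns an outcome to each position and to the seller. *Utilities.* If the platform is honest and accepts, a buyer with value $v$ has utility $v-p$ if it gets at least one item and $0$ otherwise (items and payments being summed over all identities it uses), the platform has utility $\sum_i p_i-\mu_S$, and a coalition that behaves honestly has the sum of its members' utilities; if the platform rejects, all utilities are $0$. A strategic coalition of the platform and a set $C$ of buyers, facing honest buyers $H$, has utility $0$ if some honest player rejects, and otherwise $\sum_{i\in H}p_i-\mu_S$ plus the sum of the $\min(t-\sum_{i\in H}x_i,\,|C|)$ largest true values in $C$. *Incentive compatibility (ex post).* $\Pi_\lambda$ is *computationally IC* for a strategic individual buyer or coalition if for every polynomial $n(\cdot)$ and every non-uniform probabilistic polynomial-time strategy $S$ there is a negligible $\varepsilon$ such that for all $\lambda$, all choices of at most $n(\lambda)$ honest buyers and their identities, and all true values of the honest and the strategic buyers,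 the expected utility under $S$ is at most that under honest behavior plus $\varepsilon(\lambda)$. It is *strongly* computationally IC if moreover the inequality holds with $\varepsilon=0$ for all polynomial-time extended input replacement strategies, i.e. those that submit an arbitrary vector of bids in $\mathbb U_\lambda$ under own and fake identities (leaving out own identities if desired) and otherwise follow the honest protocol. *bIC* is this property for every single buyer, the platform being honest; *$c$-pbIC* is this property for every coalition of the platform with at least one and at most $c$ buyers. $\Pi_\lambda$ is *non-trivial* if there is a polynomially bounded positive function $q$ such that for infinitely many $\lambda$ there is a value vector over $\mathbb U_\lambda$ of length at most $q(\lambda)$ under which the expected total buyer utility in the honest execution is at least $1/q(\lambda)$. **Corollary.** Let $\Pi_\lambda$ be a non-trivial auction for selling $k$ items over the value domain $\mathbb U_\lambda\subset[0,1]$. Suppose there is a negligible function $\mathsf{negl}$ with $\mathsf{tick}(\mathbb U_\lambda)\le\mathsf{negl}(\lambda)$ for all sufficiently large $\lambda$. Then $\Pi_\lambda$ does not satisfy both strong computational bIC and strong computational $2$-pbIC (in the ex post setting). -/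

import Mathlib

open Filter
open scoped NNReal

noncomputable section

namespace PlatformAuction

/-! ### Negligible functions, value domains, identities -/

/-- A non-negative function that eventually lies below the inverse of every polynomial. -/
def Negligible (f : ℕ → ℝ) : Prop :=
  (∀ κ, 0 ≤ f κ) ∧ Asymptotics.SuperpolynomialDecay atTop (fun κ : ℕ => (κ : ℝ)) f

/-- A family of value domains: finite subsets of `[0, 1]` that contain `0`, one for each value of
the security parameter `κ`. -/
structure ValueDomain where
  dom : ℕ → Finset ℝ
  zero_mem : ∀ κ, 0 ∈ dom κ
  mem_unit : ∀ κ, ∀ a ∈ dom κ, 0 ≤ a ∧ a ≤ 1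

/-- The largest distance between two adjacent points of a finite set of reals. (The degenerate
pairs `a = b` contribute `0`, so that the maximum is over a non-empty finite set.) -/
def tick (U : Finset ℝ) : ℝ :=
  sSup {d : ℝ | ∃ a ∈ U, ∃ b ∈ U, a ≤ b ∧ (∀ c ∈ U, ¬ (a < c ∧ c < b)) ∧ d = b - a}

/-- Bit strings. They serve as identities, messages and machine configurations. -/
abbrev Str := List Bool

/-- The identity space: `carrier κ` is the set of all identities, and `fake κ` is the set of those
under which a strategic player is able to participate besides its own identity. There are
super-polynomially many of the latter. -/
structure IdentitySpace where
  carrier : ℕ → Set Str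
  fake : ℕ → Set Str
  fake_subset : ∀ κ, fake κ ⊆ carrier κ
  superpoly : ∀ q : Polynomial ℕ, ∀ᶠ κ in atTop, ((q.eval κ : ℕ) : ℕ∞) ≤ (fake κ).encard

/-! ### Communication -/

inductive Party where
  | platform : Party
  | seller : Party
  | buyer (id : Str) : Party
  deriving DecidableEq

/-- A message. The destination `none` stands for the broadcast channel (the blockchain). -/
structure Packet where
  src : Party
  dst : Option Party
  body : Str

/-- Private channels exist only between the platform and the other players; everybody may post to
the broadcast channel. -/
def Packet.Allowed (m : Packet) : Prop :=
  m.dst = none ∨ m.src = Party.platform ∨ m.dst = some Party.platform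

/-- The messages that the players in `ps` get to see. -/
def inbox (ms : List Packet) (ps : Set Party) : List Packet :=
  open scoped Classical in
  ms.filter fun m => decide (m.dst = none ∨ ∃ p ∈ ps, m.dst = some p)

/-- A strategy of the corrupted parties for one value of the security parameter: an interactive
probabilistic machine which sees all messages sent to the corrupted parties and sends messages on
their behalf. -/
structure Adversary where
  init : Str
  step : Str → List Packet → PMF (Str × List Packet)

/-- The strategy that never sends anything. -/
def Adversary.idle : Adversary where
  init := []
  step := fun s _ => PMF.pure (s, [])

/-- The honest program of an auction: a synchronous multi-round protocol of probabilistic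
interactive machines, all of which get the security parameter as an input.

* `rounds κ N` is the number of communication rounds when `N` buyers participate and the platform
  is honest;
* `initBuyer κ id v` is the initial configuration of the buyer with identity `id` and true value
  `v`; `initPlatform κ I` is that of the platform when the buyers in `I` participate (the platform
  has no other input);
* `step κ p s ms` is what party `p` does in configuration `s` on incoming messages `ms`: it moves
  to a new configuration and sends messages, `none` being the broadcast channel;
* `accept κ p s ms fs` is the final decision of party `p` to accept or reject, where `ms` are the
  incoming messages of the last round and `fs` those that the platform sent at the end;
* `buyerOutcome` and `sellerOutcome` read the outcome messages of the platform: `none` is `⊥`, a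
  buyer's outcome is the number of items it gets and its payment, and the seller's outcome
  is the number of items sold and its revenue. -/
structure Protocol where
  rounds : ℕ → ℕ → ℕ
  initBuyer : ℕ → Str → ℝ → Str
  initSeller : ℕ → Str
  initPlatform : ℕ → Finset Str → Str
  step : ℕ → Party → Str → List Packet → PMF (Str × List (Option Party × Str))
  step_finite : ∀ κ p s ms, (step κ p s ms).support.Finite
  accept : ℕ → Party → Str → List Packet → List Packet → PMF Bool
  buyerOutcome : ℕ → Str → Option (ℕ × ℝ≥0)
  sellerOutcome : ℕ → Str → Option (ℕ × ℝ≥0)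

/-- What is left at the end of an execution: the outcome message that the platform sent to each
party (empty if it sent none), and the decisions of the honest parties. -/
structure Result where
  msg : Party → Str
  acc : Party → Bool

/-- A global configuration: the configurations of the honest parties, that of the adversary, and
the messages that were sent in the last round. -/
structure Config where
  loc : Party → Str
  adv : Str
  pending : List Packet

namespace Protocol

variable (P : Protocol)

/-- One step of each of the listed honest parties, with independent randomness. -/
def honestStep (κ : ℕ) (pending : List Packet) :
    List Party → (Party → Str) → PMF ((Party → Str) × List Packet)
  | [], loc => PMF.pure (loc, [])
  | p :: ps, loc =>
    (P.step κ p (loc p) (inbox pending {p})).bind fun r =>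
    (honestStep κ pending ps (Function.update loc p r.1)).map fun r' =>
      (r'.1, r.2.map (fun m => ⟨p, m.1, m.2⟩) ++ r'.2)

/-- The final decisions of the listed honest parties, where `final` are the messages that the
platform sent after the last round. -/
def decisions (κ : ℕ) (loc : Party → Str) (pending final : List Packet) :
    List Party → PMF (Party → Bool)
  | [] => PMF.pure fun _ => false
  | p :: ps =>
    (P.accept κ p (loc p) (inbox pending {p}) (inbox final {p})).bind fun d =>
    (decisions κ loc pending final ps).map fun acc => Function.update acc p d

/-- One step of the adversary that controls the parties in `corr`. -/
def advStep (corr : Finset Party) (A : Adversary) (c : Config) : PMF (Str × List Packet) :=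
  (A.step c.adv (inbox c.pending corr)).map fun r => (r.1, r.2.filter fun m => m.src ∈ corr)

/-- One synchronous round: everybody reads the messages of the previous round and sends new
ones. -/
def round (κ : ℕ) (hon : List Party) (corr : Finset Party) (A : Adversary) (c : Config) :
    PMF Config :=
  (P.honestStep κ c.pending hon c.loc).bind fun h =>
  (advStep corr A c).map fun a =>
    ⟨h.1, a.1, open scoped Classical in (h.2 ++ a.2).filter fun m => decide m.Allowed⟩

/-- The configuration after `T` rounds. -/
def afterRounds (κ : ℕ) (hon : List Party) (corr : Finset Party) (A : Adversary) (c : Config) :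
    ℕ → PMF Config
  | 0 => PMF.pure c
  | T + 1 => (afterRounds κ hon corr A c T).bind (P.round κ hon corr A)

/-- The messages that the platform (honest, or played by the adversary) sends after the last
round, and the final configurations of the honest parties. -/
def finalStep (κ : ℕ) (corr : Finset Party) (A : Adversary) (c : Config) :
    PMF ((Party → Str) × List Packet) :=
  if Party.platform ∈ corr then
    (advStep corr A c).map fun a =>
      (c.loc, a.2.filter fun m => m.src = Party.platform)
  else
    P.honestStep κ c.pending [Party.platform] c.loc

/-- The outcome message of the platform to party `p`: the first message sent to `p` privately after
the last round. -/
def outcomeMsg (final : List Packet) (p : Party) : Str :=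
  ((final.find? fun m => m.dst = some p).map Packet.body).getD []

/-- The execution of the protocol by the honest parties `hon` against the adversary `A`, which
controls the parties in `corr`, with `T` rounds of communication. -/
def run (κ : ℕ) (hon : List Party) (corr : Finset Party) (init : Party → Str) (A : Adversary)
    (T : ℕ) : PMF Result :=
  (P.afterRounds κ hon corr A ⟨init, A.init, []⟩ T).bind fun c =>
  (P.finalStep κ corr A c).bind fun f =>
  (P.decisions κ f.1 c.pending f.2 hon).map fun acc => ⟨outcomeMsg f.2, acc⟩

/-- Initial configurations when the identities in `I` register with the platform and the honest
buyers are those in `H`, with true values `v`. -/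
def initial (κ : ℕ) (I H : Finset Str) (v : Str → ℝ) : Party → Str
  | Party.platform => P.initPlatform κ I
  | Party.seller => P.initSeller κ
  | Party.buyer i => if i ∈ H then P.initBuyer κ i (v i) else []

/-- The execution with an honest platform and an honest seller, honest buyers `H` with true values
`v`, and an adversary that participates under the buyer identities in `F`. -/
def buyerRun (κ : ℕ) (H F : Finset Str) (v : Str → ℝ) (A : Adversary) : PMF Result :=
  P.run κ (Party.platform :: Party.seller :: H.toList.map Party.buyer) (F.image Party.buyer)
    (P.initial κ (H ∪ F) H v) A (P.rounds κ (H ∪ F).card)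

/-- The execution with an honest seller, honest buyers `H` with true values `v`, and an adversary
that controls the platform and the buyer identities in `F` and ends the protocol after `T`
rounds. -/
def platformRun (κ : ℕ) (H F : Finset Str) (v : Str → ℝ) (A : Adversary) (T : ℕ) : PMF Result :=
  P.run κ (Party.seller :: H.toList.map Party.buyer)
    (insert Party.platform (F.image Party.buyer)) (P.initial κ ∅ H v) A T

/-- The execution in which everybody is honest and the participating buyers are those in `I`, with
inputs `b`. -/
def honestRun (κ : ℕ) (I : Finset Str) (b : Str → ℝ) : PMF Result :=
  P.buyerRun κ I ∅ b Adversary.idle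

/-- The number of items allocated to buyer `i`. -/
def items (κ : ℕ) (r : Result) (i : Str) : ℕ :=
  ((P.buyerOutcome κ (r.msg (Party.buyer i))).getD (0, 0)).1

/-- The payment of buyer `i`. -/
def pay (κ : ℕ) (r : Result) (i : Str) : ℝ≥0 :=
  ((P.buyerOutcome κ (r.msg (Party.buyer i))).getD (0, 0)).2

/-- The number of items sold, as told to the seller. -/
def sold (κ : ℕ) (r : Result) : ℕ :=
  ((P.sellerOutcome κ (r.msg Party.seller)).getD (0, 0)).1

/-- The revenue of the seller. -/
def sellerRevenue (κ : ℕ) (r : Result) : ℝ≥0 :=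
  ((P.sellerOutcome κ (r.msg Party.seller)).getD (0, 0)).2

/-- The joint outcome of the buyers in `I` and the seller. -/
def outcome (κ : ℕ) (I : Finset Str) (r : Result) : (Str → ℕ × ℝ≥0) × (ℕ × ℝ≥0) :=
  (fun i => if i ∈ I then (P.items κ r i, P.pay κ r i) else (0, 0),
    (P.sold κ r, P.sellerRevenue κ r))

/-- Weak symmetry: the outcome of the honest protocol is distributed as follows. First sort the
bids by value, where ties are broken by a possibly randomized rule that may depend on the
identities; then run a randomized algorithm on the sorted vector of values, whose output assigns
a private outcome to each position in the sorted vector, and an outcome to the seller. -/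
def WeaklySymmetric (U : ValueDomain) (Id : IdentitySpace) : Prop :=
  ∀ κ, ∃ (sortRule : Finset Str → (Str → ℝ) → PMF (List Str))
    (alg : List ℝ → PMF (List (ℕ × ℝ≥0) × (ℕ × ℝ≥0))),
    ∀ (I : Finset Str) (b : Str → ℝ), (I : Set Str) ⊆ Id.carrier κ →
      (∀ i ∈ I, b i ∈ U.dom κ) →
      (∀ l ∈ (sortRule I b).support,
        l.Nodup ∧ l.toFinset = I ∧ l.Pairwise fun i j => b j ≤ b i) ∧
      (P.honestRun κ I b).map (P.outcome κ I) =
        (sortRule I b).bind fun l =>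
        (alg (l.map b)).map fun o =>
          (fun i => if i ∈ l then o.1.getD (l.idxOf i) (0, 0) else (0, 0), o.2)

end Protocol

/-- A platform-assisted auction for `k` identical items: a protocol with the guarantees below, in
which `H` are the honest buyers and `F` are the buyer identities used by strategic players. -/
structure Auction (k : ℕ) (U : ValueDomain) (Id : IdentitySpace) extends Protocol where
  sold_le : ∀ κ m t μ, sellerOutcome κ m = some (t, μ) → t ≤ k
  /-- Correctness: if the platform is honest, then all honest players agree on whether to accept. -/
  correct : ∀ κ (H F : Finset Str) v A, (↑(H ∪ F) : Set Str) ⊆ Id.carrier κ → Disjoint H F →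
    (∀ i ∈ H, v i ∈ U.dom κ) → ∀ r ∈ (toProtocol.buyerRun κ H F v A).support,
      r.acc Party.seller = r.acc Party.platform ∧
        ∀ i ∈ H, r.acc (Party.buyer i) = r.acc Party.platform
  /-- Correctness: if everybody is honest, then everybody accepts. -/
  honest_accept : ∀ κ (I : Finset Str) b, (I : Set Str) ⊆ Id.carrier κ →
    (∀ i ∈ I, b i ∈ U.dom κ) → ∀ r ∈ (toProtocol.honestRun κ I b).support,
      r.acc Party.platform = true ∧ r.acc Party.seller = true ∧
        ∀ i ∈ I, r.acc (Party.buyer i) = true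
  /-- Individual rationality, when the platform is honest. -/
  rational : ∀ κ (H F : Finset Str) v A, (↑(H ∪ F) : Set Str) ⊆ Id.carrier κ → Disjoint H F →
    (∀ i ∈ H, v i ∈ U.dom κ) → ∀ r ∈ (toProtocol.buyerRun κ H F v A).support,
      ∀ i ∈ H, r.acc (Party.buyer i) = true →
        ∃ x p, toProtocol.buyerOutcome κ (r.msg (Party.buyer i)) = some (x, p) ∧ x ≤ 1 ∧
          0 ≤ x * v i - p
  /-- Individual rationality, when the platform is strategic. -/
  rational' : ∀ κ (H F : Finset Str) v A T, (↑(H ∪ F) : Set Str) ⊆ Id.carrier κ → Disjoint H F →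
    (∀ i ∈ H, v i ∈ U.dom κ) → ∀ r ∈ (toProtocol.platformRun κ H F v A T).support,
      ∀ i ∈ H, r.acc (Party.buyer i) = true →
        ∃ x p, toProtocol.buyerOutcome κ (r.msg (Party.buyer i)) = some (x, p) ∧ x ≤ 1 ∧
          0 ≤ x * v i - p
  /-- Consistency on the number of items sold and budget feasibility, when the platform is
  honest. -/
  consistent : ∀ κ (H F : Finset Str) v A, (↑(H ∪ F) : Set Str) ⊆ Id.carrier κ → Disjoint H F →
    (∀ i ∈ H, v i ∈ U.dom κ) → ∀ r ∈ (toProtocol.buyerRun κ H F v A).support,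
      r.acc Party.platform = true →
        toProtocol.sold κ r = ∑ i ∈ H ∪ F, toProtocol.items κ r i ∧
        toProtocol.sellerRevenue κ r ≤ ∑ i ∈ H ∪ F, toProtocol.pay κ r i
  weaklySymmetric : toProtocol.WeaklySymmetric U Id

/-! ### Non-uniform probabilistic polynomial time -/

/-- The tape alphabet of the machines: bits and a separator `none`. -/
abbrev Sym := Option Bool

def encStr (s : Str) : List Sym := s.map some ++ [none]

def Party.code : Party → Str
  | Party.platform => [true, true]
  | Party.seller => [true, false]
  | Party.buyer i => false :: i

def Party.decode : Str → Option Party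
  | [true, true] => some Party.platform
  | [true, false] => some Party.seller
  | false :: i => some (Party.buyer i)
  | _ => none

/-- A packet as three separated words; the empty word is the code of the broadcast channel. -/
def Packet.encode (m : Packet) : List Sym :=
  encStr m.src.code ++ encStr ((m.dst.map Party.code).getD []) ++ encStr m.body

/-- The words on a tape, as separated by `none`. -/
def splitWords (w : List Sym) : List Str := (w.splitOn none).map List.reduceOption

/-- Reads a list of packets off a list of words; a triple of words that is not the code of a packet
is ignored. -/
def parsePackets : List Str → List Packet
  | s :: d :: b :: ws =>
    match Party.decode s, d, Party.decode d with
    | some s', [], _ => ⟨s', none, b⟩ :: parsePackets ws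
    | some s', _ :: _, some d' => ⟨s', some d', b⟩ :: parsePackets ws
    | _, _, _ => parsePackets ws
  | _ => []

/-- The input tape of a machine: the security parameter in unary, random coins, and the first `q`
symbols of its own configuration followed by the incoming messages. -/
def inputTape (κ q : ℕ) (coins s : Str) (ms : List Packet) : List Sym :=
  encStr (List.replicate κ true) ++ encStr coins ++
    (encStr s ++ ms.flatMap Packet.encode).take q

/-- A family of strategies is non-uniform probabilistic polynomial time. The non-uniform advice of
polynomial length is the initial configuration, each step is carried out by one polynomial-time
Turing machine that uses polynomially many coins, and within each step the machine reads at most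
polynomially many symbols, so that the work per step is polynomial in the security parameter. -/
def IsPPTMachine (A : ℕ → Adversary) : Prop :=
  ∃ (q : Polynomial ℕ) (f : List Sym → List Sym),
    Nonempty (Turing.TM2ComputableInPolyTime (id : List Sym → List Sym) id f) ∧
    (∀ κ, (A κ).init.length ≤ q.eval κ) ∧
    ∀ κ s ms, (A κ).step s ms =
      (PMF.uniformOfFintype (Fin (q.eval κ) → Bool)).map fun coins =>
        let ws := splitWords (f (inputTape κ (q.eval κ) (List.ofFn coins) s ms))
        (ws.headD [], parsePackets ws.tail)

/-- A strategy of a player or coalition: a machine, the number of rounds after which it ends the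
protocol (relevant only if it controls the platform), and the buyer identities under which it
participates; for each value of the security parameter. -/
structure Strategy where
  adv : ℕ → Adversary
  rounds : ℕ → ℕ
  ids : ℕ → Finset Str

/-- A family of sets of identities, of polynomial total size. -/
def PolySize (F : ℕ → Finset Str) : Prop :=
  ∃ q : Polynomial ℕ, ∀ κ, (F κ).card ≤ q.eval κ ∧ ∀ i ∈ F κ, i.length ≤ q.eval κ

def Strategy.IsPPT (S : Strategy) : Prop :=
  IsPPTMachine S.adv ∧ (∃ q : Polynomial ℕ, ∀ κ, S.rounds κ ≤ q.eval κ) ∧ PolySize S.ids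

/-- An extended input replacement strategy: participate under the identities in `ids` (own
identities may be left out, and fake ones added), use the bids `bid` as inputs, and otherwise
follow the honest protocol. -/
structure InputReplacement where
  ids : ℕ → Finset Str
  bid : ℕ → Str → ℝ

/-! ### Utilities -/

/-- The expectation of `f` under `μ`. -/
def expect {α : Type} (μ : PMF α) (f : α → ℝ) : ℝ := ∑' a, (μ a).toReal * f a

/-- The utility of a buyer with true value `v` that gets `x` items and pays `p`. -/
def buyerUtil (v : ℝ) (x : ℕ) (p : ℝ) : ℝ := if 0 < x then v - p else 0

/-- The sum of the `min m |C|` largest values of the buyers in `C`. -/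
def topSum (C : Finset Str) (v : Str → ℝ) (m : ℕ) : ℝ :=
  (C.powersetCard (min m C.card)).sup'
    (Finset.powersetCard_nonempty.2 (min_le_right _ _)) fun B => ∑ i ∈ B, v i

namespace Protocol

variable (P : Protocol)

/-- With an honest platform, the utility of a buyer with true value `v` that participates under the
identities in `F`. -/
def utilBuyer (κ : ℕ) (F : Finset Str) (v : ℝ) (r : Result) : ℝ :=
  if r.acc Party.platform = true then
    buyerUtil v (∑ i ∈ F, P.items κ r i) (∑ i ∈ F, (P.pay κ r i : ℝ)) else 0

/-- With an honest platform, the utility of the platform when the buyers in `I` participate. -/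
def utilPlatform (κ : ℕ) (I : Finset Str) (r : Result) : ℝ :=
  if r.acc Party.platform = true then
    ∑ i ∈ I, (P.pay κ r i : ℝ) - P.sellerRevenue κ r else 0

/-- The trace is safe: all honest players (the seller and the buyers in `H`) accept. -/
def Safe (H : Finset Str) (r : Result) : Prop :=
  r.acc Party.seller = true ∧ ∀ i ∈ H, r.acc (Party.buyer i) = true

/-- The utility of a strategic coalition of the platform and the buyers in `C`, with true values
`v`, against the honest buyers `H`: it is `0` on unsafe traces, and otherwise the coalition keeps
what the honest buyers pay minus what the seller gets, and hands the items that did not go to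
honest buyers to its members with the highest true values. -/
def utilCoalition (κ : ℕ) (H C : Finset Str) (v : Str → ℝ) (r : Result) : ℝ :=
  open scoped Classical in
  if Safe H r then
    ∑ i ∈ H, (P.pay κ r i : ℝ) - P.sellerRevenue κ r +
      topSum C v (P.sold κ r - ∑ i ∈ H, P.items κ r i) else 0

/-- The utility of the coalition of the platform and the buyers in `C` when everybody is honest: the
sum of the utilities of its members. -/
def utilHonestCoalition (κ : ℕ) (H C : Finset Str) (v : Str → ℝ) (r : Result) : ℝ :=
  P.utilPlatform κ (H ∪ C) r + ∑ i ∈ C, P.utilBuyer κ {i} (v i) r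

/-- The execution in which the honest buyers `H` use their true values `v`, and a coalition
participates under the identities in `F` with inputs `b` and otherwise follows the honest
protocol. -/
def replacedRun (κ : ℕ) (H F : Finset Str) (v b : Str → ℝ) : PMF Result :=
  P.honestRun κ (H ∪ F) (H.piecewise v b)

end Protocol

/-! ### Incentive compatibility -/

/-- Honest buyers `H` and colluding buyers `C`, with true values `v`, and the identities `F` used
by the coalition, which are its own or ones that it is able to create. -/
def Scenario (U : ValueDomain) (Id : IdentitySpace) (κ : ℕ) (H C F : Finset Str) (v : Str → ℝ) :
    Prop :=
  (H : Set Str) ⊆ Id.carrier κ ∧ (C : Set Str) ⊆ Id.carrier κ ∧ Disjoint H C ∧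
    (∀ i ∈ H ∪ C, v i ∈ U.dom κ) ∧ (∀ i ∈ F, i ∈ C ∨ i ∈ Id.fake κ) ∧ Disjoint H F

/-- A strategic platform must obtain enough items from the seller to distribute to the honest buyers:
on every safe trace, the number of items sold as viewed by the seller is at least the number of
items that honest buyers get. -/
def Strategy.Deliverable (S : Strategy) (P : Protocol) (U : ValueDomain) (Id : IdentitySpace)
    (C : ℕ → Finset Str) (n : Polynomial ℕ) : Prop :=
  ∀ κ (H : Finset Str) v, Scenario U Id κ H (C κ) (S.ids κ) v → H.card ≤ n.eval κ →
    ∀ r ∈ (P.platformRun κ H (S.ids κ) v (S.adv κ) (S.rounds κ)).support, Protocol.Safe H r →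
      ∑ i ∈ H, P.items κ r i ≤ P.sold κ r

namespace Auction

variable {k : ℕ} {U : ValueDomain} {Id : IdentitySpace} (P : Auction k U Id)

/-- Computational (ex post) buyer incentive compatibility. -/
def CompBIC : Prop :=
  ∀ (n : Polynomial ℕ) (c : ℕ → Str) (S : Strategy), S.IsPPT →
    ∃ ε : ℕ → ℝ, Negligible ε ∧
      ∀ κ (H : Finset Str) v, Scenario U Id κ H {c κ} (S.ids κ) v → H.card ≤ n.eval κ →
        expect (P.buyerRun κ H (S.ids κ) v (S.adv κ)) (P.utilBuyer κ (S.ids κ) (v (c κ)))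
          ≤ expect (P.honestRun κ (H ∪ {c κ}) v) (P.utilBuyer κ {c κ} (v (c κ))) + ε κ

/-- Exact buyer incentive compatibility against polynomial-time extended input replacement. -/
def ReplacementBIC : Prop :=
  ∀ (n : Polynomial ℕ) (c : ℕ → Str) (R : InputReplacement), PolySize R.ids →
    ∀ κ (H : Finset Str) v, Scenario U Id κ H {c κ} (R.ids κ) v → H.card ≤ n.eval κ →
      (∀ i ∈ R.ids κ, R.bid κ i ∈ U.dom κ) →
      expect (P.replacedRun κ H (R.ids κ) v (R.bid κ)) (P.utilBuyer κ (R.ids κ) (v (c κ)))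
        ≤ expect (P.honestRun κ (H ∪ {c κ}) v) (P.utilBuyer κ {c κ} (v (c κ)))

/-- Strong computational (ex post) buyer incentive compatibility. -/
def StrongCompBIC : Prop := P.CompBIC ∧ P.ReplacementBIC

/-- Computational (ex post) incentive compatibility for coalitions of the platform and at least one
and at most `m` buyers. -/
def CompPBIC (m : ℕ) : Prop :=
  ∀ (n : Polynomial ℕ) (C : ℕ → Finset Str), (∀ κ, (C κ).Nonempty ∧ (C κ).card ≤ m) →
    ∀ S : Strategy, S.IsPPT → S.Deliverable P.toProtocol U Id C n →
    ∃ ε : ℕ → ℝ, Negligible ε ∧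
      ∀ κ (H : Finset Str) v, Scenario U Id κ H (C κ) (S.ids κ) v → H.card ≤ n.eval κ →
        expect (P.platformRun κ H (S.ids κ) v (S.adv κ) (S.rounds κ)) (P.utilCoalition κ H (C κ) v)
          ≤ expect (P.honestRun κ (H ∪ C κ) v) (P.utilHonestCoalition κ H (C κ) v) + ε κ

/-- Exact incentive compatibility for coalitions of the platform and at least one and at most `m`
buyers, against polynomial-time extended input replacement. -/
def ReplacementPBIC (m : ℕ) : Prop :=
  ∀ (n : Polynomial ℕ) (C : ℕ → Finset Str), (∀ κ, (C κ).Nonempty ∧ (C κ).card ≤ m) →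
    ∀ R : InputReplacement, PolySize R.ids →
    ∀ κ (H : Finset Str) v, Scenario U Id κ H (C κ) (R.ids κ) v → H.card ≤ n.eval κ →
      (∀ i ∈ R.ids κ, R.bid κ i ∈ U.dom κ) →
      expect (P.replacedRun κ H (R.ids κ) v (R.bid κ)) (P.utilCoalition κ H (C κ) v)
        ≤ expect (P.honestRun κ (H ∪ C κ) v) (P.utilHonestCoalition κ H (C κ) v)

/-- Strong computational (ex post) `m`-platform-buyer incentive compatibility. -/
def StrongCompPBIC (m : ℕ) : Prop := P.CompPBIC m ∧ P.ReplacementPBIC m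

/-- Non-triviality: for infinitely many values of the security parameter there is a value vector of
polynomial length under which the expected total buyer utility is at least an inverse
polynomial. -/
def NonTrivial : Prop :=
  ∃ q : Polynomial ℕ, (∀ κ : ℕ, 0 < q.eval κ) ∧ ∃ᶠ κ : ℕ in atTop,
    ∃ (I : Finset Str) (b : Str → ℝ), (I : Set Str) ⊆ Id.carrier κ ∧ (∀ i ∈ I, b i ∈ U.dom κ) ∧
      I.card ≤ q.eval κ ∧
      1 / ((q.eval κ : ℕ) : ℝ) ≤
        expect (P.honestRun κ I b) fun r => ∑ i ∈ I, P.utilBuyer κ {i} (b i) r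

end Auction

end PlatformAuction

end

/-! All deviations used are input replacements, for which the incentive inequalities are exact at
each security parameter. Fix one buyer `d` and let its bid vary. By bIC, minus its payment is a
payment rule making its allocation rule truthful. By pbIC for a coalition of the platform, `d` and
perhaps a partner, the same quantity plus the platform's surplus and the partner's utility also
makes that allocation truthful. Two such rules differ by a constant up to one tick
(`abs_sub_le_tick`), so surplus plus partner utility barely depends on the bid of `d`
(`abs_coalition_sub_le`).

Without a partner, lowering the bids to zero one at a time shows that the surplus is at most a tick
per buyer (`surplus_le`). With a partner `c`, it follows that the utility of `c` barely depends on
the bids of others (`gain_le_gain_add`). A coalition of the platform, `c` and a zero-value buyer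
could leave the latter out, so adding zero-value buyers barely hurts `c` (`gain_le_gain_of_subset`).

Now enlarge the set of buyers to a set `J` of polynomial size, taken from the abundant identities.
Weak symmetry makes the utility of a lone positive bidder independent of its identity
(`gain_single_eq`). When all of `J` bid the value of `c`, everyone therefore gets nearly the
original utility of `c`, while only `k` items are available (`card_mul_gain_sub_le`). Each utility
is thus at most about `k / |J|`, and a negligible tick contradicts non-triviality for suitable `J`.
-/

noncomputable section

namespace PlatformAuction

/-! ### Expectations under distributions with finite support -/

section Expect

variable {α β : Type} {μ : PMF α}

theorem expect_eq_sum (h : μ.support.Finite) (f : α → ℝ) :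
    expect μ f = ∑ a ∈ h.toFinset, (μ a).toReal * f a := by
  refine tsum_eq_sum fun a ha => ?_
  have : μ a = 0 := by simpa [PMF.mem_support_iff] using ha
  simp [this]

theorem expect_mono (h : μ.support.Finite) {f g : α → ℝ} (hfg : ∀ a ∈ μ.support, f a ≤ g a) :
    expect μ f ≤ expect μ g := by
  rw [expect_eq_sum h, expect_eq_sum h]
  exact Finset.sum_le_sum fun a ha =>
    mul_le_mul_of_nonneg_left (hfg a (h.mem_toFinset.1 ha)) ENNReal.toReal_nonneg

theorem expect_congr {f g : α → ℝ} (hfg : ∀ a ∈ μ.support, f a = g a) :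
    expect μ f = expect μ g := by
  refine tsum_congr fun a => ?_
  by_cases ha : a ∈ μ.support
  · rw [hfg a ha]
  · have : μ a = 0 := by simpa [PMF.mem_support_iff] using ha
    simp [this]

theorem expect_add (h : μ.support.Finite) (f g : α → ℝ) :
    expect μ (fun a => f a + g a) = expect μ f + expect μ g := by
  simp only [expect_eq_sum h, mul_add, Finset.sum_add_distrib]

theorem expect_sub (h : μ.support.Finite) (f g : α → ℝ) :
    expect μ (fun a => f a - g a) = expect μ f - expect μ g := by
  simp only [expect_eq_sum h, mul_sub, Finset.sum_sub_distrib]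

theorem expect_const_mul (c : ℝ) (f : α → ℝ) :
    expect μ (fun a => c * f a) = c * expect μ f := by
  simp only [expect, ← tsum_mul_left, mul_left_comm]

theorem expect_sum (h : μ.support.Finite) {ι : Type} (s : Finset ι) (f : ι → α → ℝ) :
    expect μ (fun a => ∑ i ∈ s, f i a) = ∑ i ∈ s, expect μ (f i) := by
  simp only [expect_eq_sum h, Finset.mul_sum]
  exact Finset.sum_comm

theorem expect_const (h : μ.support.Finite) (c : ℝ) : expect μ (fun _ => c) = c := by
  have h1 : ∑ a ∈ h.toFinset, μ a = 1 := by
    rw [← μ.tsum_coe]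
    refine (tsum_eq_sum fun a ha => ?_).symm
    simpa [PMF.mem_support_iff] using ha
  rw [expect_eq_sum h, ← Finset.sum_mul, ← ENNReal.toReal_sum fun a _ => μ.apply_ne_top a, h1]
  simp

theorem expect_map (h : μ.support.Finite) (g : α → β) (f : β → ℝ) :
    expect (μ.map g) f = expect μ fun a => f (g a) := by
  classical
  have h' : (μ.map g).support.Finite := by
    rw [PMF.support_map]; exact h.image g
  have hmap : ∀ y, (μ.map g y).toReal = ∑ a ∈ h.toFinset with g a = y, (μ a).toReal := by
    intro y
    rw [← ENNReal.toReal_sum fun a _ => μ.apply_ne_top a, PMF.map_apply, Finset.sum_filter]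
    congr 1
    rw [tsum_eq_sum (s := h.toFinset)]
    · exact Finset.sum_congr rfl fun a _ => by simp [eq_comm]
    · intro a ha
      have : μ a = 0 := by simpa [PMF.mem_support_iff] using ha
      simp [this]
  rw [expect_eq_sum h', expect_eq_sum h]
  rw [← Finset.sum_fiberwise_of_maps_to (s := h.toFinset) (t := h'.toFinset) (g := g)]
  · refine Finset.sum_congr rfl fun y _ => ?_
    rw [hmap, Finset.sum_mul]
    refine Finset.sum_congr rfl fun a ha => ?_
    rw [(Finset.mem_filter.1 ha).2]
  · intro a ha
    rw [Set.Finite.mem_toFinset, PMF.support_map]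
    exact ⟨a, h.mem_toFinset.1 ha, rfl⟩

theorem finite_support_bind {ν : α → PMF β} (h : μ.support.Finite)
    (h' : ∀ a, (ν a).support.Finite) : (μ.bind ν).support.Finite := by
  rw [PMF.support_bind]
  exact h.biUnion fun a _ => h' a

theorem finite_support_map (g : α → β) (h : μ.support.Finite) : (μ.map g).support.Finite := by
  rw [PMF.support_map]; exact h.image g

theorem finite_support_pure (a : α) : (PMF.pure a).support.Finite := by
  rw [PMF.support_pure]; exact Set.finite_singleton a

end Expect

/-! ### The honest execution has finite support -/

namespace Protocol

variable (P : Protocol)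

theorem honestStep_finite (κ : ℕ) (pending : List Packet) (ps : List Party) (loc : Party → Str) :
    (P.honestStep κ pending ps loc).support.Finite := by
  induction ps generalizing loc with
  | nil => exact finite_support_pure _
  | cons p ps ih =>
    exact finite_support_bind (P.step_finite _ _ _ _) fun _ => finite_support_map _ (ih _)

theorem decisions_finite (κ : ℕ) (loc : Party → Str) (pending final : List Packet)
    (ps : List Party) : (P.decisions κ loc pending final ps).support.Finite := by
  induction ps with
  | nil => exact finite_support_pure _
  | cons p ps ih => exact finite_support_bind (Set.toFinite _) fun _ => finite_support_map _ ih

theorem advStep_idle_finite (corr : Finset Party) (c : Config) :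
    (advStep corr Adversary.idle c).support.Finite :=
  finite_support_map _ (finite_support_pure _)

/-- Each honest step has finite support and the number of rounds is fixed. Expectations over honest
executions are thus finite sums, and no summability question arises. -/
theorem honestRun_finite (κ : ℕ) (I : Finset Str) (b : Str → ℝ) :
    (P.honestRun κ I b).support.Finite := by
  have hr : ∀ hon corr c T,
      (P.afterRounds κ hon corr Adversary.idle c T).support.Finite := by
    intro hon corr c T
    induction T with
    | zero => exact finite_support_pure _
    | succ T ih =>
      exact finite_support_bind ih fun c => finite_support_bind (P.honestStep_finite _ _ _ _)
        fun _ => finite_support_map _ (advStep_idle_finite _ _)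
  refine finite_support_bind (hr _ _ _ _) fun c => finite_support_bind ?_ fun f =>
    finite_support_map _ (P.decisions_finite _ _ _ _ _)
  unfold finalStep
  split_ifs
  · exact finite_support_map _ (advStep_idle_finite _ _)
  · exact P.honestStep_finite _ _ _ _

/-- Bids enter only through the initial configurations of participants, so a profile may be altered
freely outside `I`. -/
theorem honestRun_congr (κ : ℕ) {I : Finset Str} {b b' : Str → ℝ} (h : ∀ i ∈ I, b i = b' i) :
    P.honestRun κ I b = P.honestRun κ I b' := by
  have : ∀ J, P.initial κ J I b = P.initial κ J I b' := by
    intro J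
    funext p
    cases p with
    | platform => rfl
    | seller => rfl
    | buyer i =>
      by_cases hi : i ∈ I
      · simp [initial, hi, h i hi]
      · simp [initial, hi]
  simp only [honestRun, buyerRun, this]

end Protocol

/-! ### Payment identities over a finite domain -/

theorem sub_le_tick {U : Finset ℝ} {a b : ℝ} (ha : a ∈ U) (hb : b ∈ U) (hab : a ≤ b)
    (h : ∀ c ∈ U, ¬ (a < c ∧ c < b)) : b - a ≤ tick U := by
  refine le_csSup ?_ ⟨a, ha, b, hb, hab, h, rfl⟩
  refine ((U ×ˢ U).image fun z => z.2 - z.1).bddAbove.mono ?_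
  rintro d ⟨a, ha, b, hb, -, -, rfl⟩
  simp only [Finset.coe_image, Set.mem_image]
  exact ⟨(a, b), by simp [ha, hb], rfl⟩

/-- Two payment rules that both make an allocation rule truthful differ by almost a constant. -/
theorem abs_sub_le_tick {U : Finset ℝ} {x g h : ℝ → ℝ}
    (hx : ∀ a ∈ U, 0 ≤ x a ∧ x a ≤ 1)
    (hg : ∀ v ∈ U, ∀ w ∈ U, g w + v * x w ≤ g v + v * x v)
    (hh : ∀ v ∈ U, ∀ w ∈ U, h w + v * x w ≤ h v + v * x v)
    {a b : ℝ} (ha : a ∈ U) (hb : b ∈ U) : |(g b - h b) - (g a - h a)| ≤ tick U := by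
  -- The factor `x b - x a` makes the bound telescope along adjacent points. The induction is on the
  -- number of domain points strictly between `a` and `b`.
  have key : ∀ n : ℕ, ∀ a ∈ U, ∀ b ∈ U, a ≤ b → (U.filter fun c => a < c ∧ c < b).card ≤ n →
      |(g b - h b) - (g a - h a)| ≤ tick U * (x b - x a) := by
    intro n
    induction n with
    | zero =>
      intro a ha b hb hab hn
      have hadj : ∀ c ∈ U, ¬ (a < c ∧ c < b) :=
        Finset.filter_eq_empty_iff.1 (Finset.card_eq_zero.1 (Nat.le_zero.1 hn))
      have ht := sub_le_tick ha hb hab hadj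
      -- Truthfulness at both ends confines `g b - g a` and `h b - h a` to the same interval `[-b *
      -- (x b - x a), -a * (x b - x a)]`, of length at most `tick U * (x b - x a)`.
      have g1 := hg a ha b hb
      have g2 := hg b hb a ha
      have h1 := hh a ha b hb
      have h2 := hh b hb a ha
      rcases hab.eq_or_lt with rfl | hlt
      · simp
      have hmono : 0 ≤ x b - x a := by
        by_contra! hc
        nlinarith [mul_pos (sub_pos.2 hlt) (neg_pos.2 hc)]
      have := mul_le_mul_of_nonneg_right ht hmono
      rw [abs_le]
      constructor <;> nlinarith
    | succ n ih =>
      intro a ha b hb hab hn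
      by_cases hadj : ∃ c ∈ U, a < c ∧ c < b
      · obtain ⟨c, hc, hac, hcb⟩ := hadj
        have hlt : ∀ V : Finset ℝ, V ⊆ (U.filter fun c => a < c ∧ c < b) → c ∉ V →
            V.card ≤ n := by
          intro V hV hcV
          have : V.card < (U.filter fun c => a < c ∧ c < b).card :=
            Finset.card_lt_card ⟨hV, fun hs => hcV (hs (by simp [hc, hac, hcb]))⟩
          omega
        have i1 := ih a ha c hc hac.le (hlt _ (fun e he => by
          simp only [Finset.mem_filter] at he ⊢
          exact ⟨he.1, he.2.1, he.2.2.trans hcb⟩) (by simp))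
        have i2 := ih c hc b hb hcb.le (hlt _ (fun e he => by
          simp only [Finset.mem_filter] at he ⊢
          exact ⟨he.1, hac.trans he.2.1, he.2.2⟩) (by simp))
        rw [abs_le] at i1 i2 ⊢
        constructor <;> nlinarith
      · push Not at hadj
        refine ih a ha b hb hab (le_of_eq_of_le ?_ (Nat.zero_le n))
        rw [Finset.card_eq_zero, Finset.filter_eq_empty_iff]
        exact fun c hc h => absurd h.2 (not_lt.2 (hadj c hc h.1))
  have h0 : 0 ≤ tick U := by
    simpa using sub_le_tick ha ha le_rfl fun c _ h => lt_asymm h.1 h.2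
  rcases le_total a b with hab | hab
  · refine (key _ a ha b hb hab le_rfl).trans (mul_le_of_le_one_right h0 ?_)
    linarith [hx a ha, hx b hb]
  · rw [abs_sub_comm]
    refine (key _ b hb a ha hab le_rfl).trans (mul_le_of_le_one_right h0 ?_)
    linarith [hx a ha, hx b hb]

theorem ValueDomain.tick_nonneg (U : ValueDomain) (κ : ℕ) : 0 ≤ tick (U.dom κ) := by
  simpa using sub_le_tick (U.zero_mem κ) (U.zero_mem κ) le_rfl fun c _ h => lt_asymm h.1 h.2

/-- The members that receive an item form one of the sets over which `topSum` is the maximum: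
redistribution inside a coalition cannot lose value. -/
theorem sum_mul_le_topSum {C F : Finset Str} (hF : F ⊆ C) (v : Str → ℝ) {x : Str → ℕ}
    (hx : ∀ i ∈ F, x i ≤ 1) : ∑ i ∈ F, v i * x i ≤ topSum C v (∑ i ∈ F, x i) := by
  have hx' : ∀ i ∈ F, x i = if x i = 1 then 1 else 0 := by
    intro i hi
    have := hx i hi
    split_ifs <;> omega
  have hcard : ∑ i ∈ F, x i = (F.filter fun i => x i = 1).card := by
    rw [Finset.card_filter]
    exact Finset.sum_congr rfl hx'
  have hsum : ∑ i ∈ F, v i * x i = ∑ i ∈ F with x i = 1, v i := by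
    rw [Finset.sum_filter]
    refine Finset.sum_congr rfl fun i hi => ?_
    have := hx i hi
    split_ifs with h1
    · simp [h1]
    · simp [show x i = 0 by omega]
  have hsub : (F.filter fun i => x i = 1) ⊆ C := (Finset.filter_subset _ _).trans hF
  rw [hsum, hcard]
  unfold topSum
  refine Finset.le_sup' (f := fun B : Finset Str => ∑ i ∈ B, v i) ?_
  rw [Finset.mem_powersetCard]
  exact ⟨hsub, (min_eq_left (Finset.card_le_card hsub)).symm⟩

/-- The exact incentive inequalities are read off at a single security parameter, where a constant
family of identities suffices. -/
theorem polySize_const (F : Finset Str) : PolySize fun _ => F := by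
  refine ⟨Polynomial.C (F.card + F.sup List.length), fun κ => ?_⟩
  simp only [Polynomial.eval_C]
  exact ⟨Nat.le_add_right _ _, fun i hi =>
    (Finset.le_sup (f := List.length) hi).trans (Nat.le_add_left _ _)⟩

/-! ### Traces and expected utilities of the honest execution -/

namespace Auction

/-- The buyers in `I` and their bids `b` are legitimate inputs of the auction. -/
structure Admissible (U : ValueDomain) (Id : IdentitySpace) (κ : ℕ) (I : Finset Str)
    (b : Str → ℝ) : Prop where
  carrier : (I : Set Str) ⊆ Id.carrier κ
  mem : ∀ i ∈ I, b i ∈ U.dom κ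

variable {k : ℕ} {U : ValueDomain} {Id : IdentitySpace} (P : Auction k U Id) {κ : ℕ}
  {I : Finset Str} {b b' : Str → ℝ}

/-- What holds on every trace of the honest execution. -/
structure HonestTrace (κ : ℕ) (I : Finset Str) (b : Str → ℝ) (r : Result) : Prop where
  acc : r.acc Party.platform = true
  safe : Protocol.Safe I r
  items_le : ∀ i ∈ I, P.items κ r i ≤ 1
  pay_le : ∀ i ∈ I, (P.pay κ r i : ℝ) ≤ P.items κ r i * b i
  sold_eq : P.sold κ r = ∑ i ∈ I, P.items κ r i
  revenue_le : (P.sellerRevenue κ r : ℝ) ≤ ∑ i ∈ I, (P.pay κ r i : ℝ)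

theorem honestTrace (h : Admissible U Id κ I b) {r : Result}
    (hr : r ∈ (P.honestRun κ I b).support) : P.HonestTrace κ I b r := by
  obtain ⟨h1, h2, h3⟩ := P.honest_accept κ I b h.carrier h.mem r hr
  have hu : (↑(I ∪ ∅) : Set Str) ⊆ Id.carrier κ := by simpa using h.carrier
  have hrat := P.rational κ I ∅ b Adversary.idle hu (Finset.disjoint_empty_right _) h.mem r hr
  have hcon := P.consistent κ I ∅ b Adversary.idle hu (Finset.disjoint_empty_right _) h.mem r hr h1
  rw [Finset.union_empty] at hcon
  refine ⟨h1, ⟨h2, h3⟩, fun i hi => ?_, fun i hi => ?_, hcon.1, mod_cast hcon.2⟩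
  · obtain ⟨x, p, hxp, hx, -⟩ := hrat i hi (h3 i hi)
    simpa [Protocol.items, hxp] using hx
  · obtain ⟨x, p, hxp, -, hp⟩ := hrat i hi (h3 i hi)
    simpa [Protocol.items, Protocol.pay, hxp] using hp

theorem sold_le_supply (r : Result) : P.sold κ r ≤ k := by
  unfold Protocol.sold
  cases h : P.sellerOutcome κ (r.msg Party.seller) with
  | none => simp
  | some z => exact P.sold_le κ _ _ _ h

/-- The expected number of items of buyer `i` in the honest execution. -/
def meanItems (κ : ℕ) (I : Finset Str) (b : Str → ℝ) (i : Str) : ℝ :=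
  expect (P.honestRun κ I b) fun r => P.items κ r i

/-- The expected payment of buyer `i` in the honest execution. -/
def meanPay (κ : ℕ) (I : Finset Str) (b : Str → ℝ) (i : Str) : ℝ :=
  expect (P.honestRun κ I b) fun r => P.pay κ r i

/-- The expected utility of the platform in the honest execution. -/
def surplus (κ : ℕ) (I : Finset Str) (b : Str → ℝ) : ℝ :=
  expect (P.honestRun κ I b) fun r => ∑ i ∈ I, (P.pay κ r i : ℝ) - P.sellerRevenue κ r

/-- The expected utility of buyer `i` with true value `v` in the honest execution with bids `b`. -/
def gain (κ : ℕ) (I : Finset Str) (b : Str → ℝ) (v : ℝ) (i : Str) : ℝ :=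
  v * P.meanItems κ I b i - P.meanPay κ I b i

theorem gain_eq_expect (κ : ℕ) (I : Finset Str) (b : Str → ℝ) (v : ℝ) (i : Str) :
    P.gain κ I b v i =
      expect (P.honestRun κ I b) fun r => v * (P.items κ r i : ℝ) - P.pay κ r i := by
  rw [expect_sub (P.honestRun_finite κ I b), expect_const_mul]
  rfl

theorem gain_congr (h : ∀ i ∈ I, b i = b' i) (v : ℝ) (i : Str) :
    P.gain κ I b v i = P.gain κ I b' v i := by
  simp only [gain, meanItems, meanPay, P.honestRun_congr κ h]

theorem surplus_congr (h : ∀ i ∈ I, b i = b' i) : P.surplus κ I b = P.surplus κ I b' := by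
  simp only [surplus, P.honestRun_congr κ h]

variable {P} in
-- Individual rationality with respect to the bid forces payment zero when no item is received.
-- Utility is therefore linear in the true value, even when the bid differs from it.
theorem HonestTrace.utilBuyer_eq {r : Result} (h : P.HonestTrace κ I b r) {i : Str} (hi : i ∈ I)
    (v : ℝ) : P.utilBuyer κ {i} v r = v * (P.items κ r i : ℝ) - P.pay κ r i := by
  have h1 := h.items_le i hi
  have h2 := h.pay_le i hi
  simp only [Protocol.utilBuyer, h.acc, if_true, Finset.sum_singleton, buyerUtil]
  have hp : (0 : ℝ) ≤ P.pay κ r i := NNReal.coe_nonneg _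
  rcases Nat.le_one_iff_eq_zero_or_eq_one.1 h1 with h0 | h0
  · simp only [h0, Nat.cast_zero, zero_mul] at h2
    simp only [h0, lt_irrefl, if_false, Nat.cast_zero]
    linarith
  · simp [h0]

theorem expect_utilBuyer (h : Admissible U Id κ I b) {i : Str} (hi : i ∈ I) (v : ℝ) :
    expect (P.honestRun κ I b) (P.utilBuyer κ {i} v) = P.gain κ I b v i := by
  rw [gain_eq_expect]
  exact expect_congr fun r hr => (P.honestTrace h hr).utilBuyer_eq hi v

theorem surplus_nonneg (h : Admissible U Id κ I b) : 0 ≤ P.surplus κ I b := by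
  have hf := P.honestRun_finite κ I b
  rw [← expect_const hf 0]
  exact expect_mono hf fun r hr => sub_nonneg.2 (P.honestTrace h hr).revenue_le

theorem surplus_zero_le (h : Admissible U Id κ I b) (h0 : ∀ i ∈ I, b i = 0) :
    P.surplus κ I b ≤ 0 := by
  have hf := P.honestRun_finite κ I b
  rw [← expect_const hf 0]
  refine expect_mono hf fun r hr => ?_
  have : ∑ i ∈ I, (P.pay κ r i : ℝ) ≤ 0 := Finset.sum_nonpos fun i hi => by
    simpa [h0 i hi] using (P.honestTrace h hr).pay_le i hi
  have hs : (0 : ℝ) ≤ P.sellerRevenue κ r := NNReal.coe_nonneg _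
  linarith

theorem meanItems_mem (h : Admissible U Id κ I b) {i : Str} (hi : i ∈ I) :
    0 ≤ P.meanItems κ I b i ∧ P.meanItems κ I b i ≤ 1 := by
  have hf := P.honestRun_finite κ I b
  constructor
  · rw [← expect_const hf 0]
    exact expect_mono hf fun r _ => Nat.cast_nonneg _
  · rw [← expect_const hf 1]
    exact expect_mono hf fun r hr => mod_cast (P.honestTrace h hr).items_le i hi

theorem gain_zero_nonpos (κ : ℕ) (I : Finset Str) (b : Str → ℝ) (i : Str) :
    P.gain κ I b 0 i ≤ 0 := by
  have hf := P.honestRun_finite κ I b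
  rw [gain_eq_expect]
  refine (expect_mono hf fun r _ => ?_).trans_eq (expect_const hf 0)
  simp

/-- The total utility of the buyers is at most the number of items. -/
theorem sum_gain_le (h : Admissible U Id κ I b) : ∑ i ∈ I, P.gain κ I b (b i) i ≤ k := by
  have hf := P.honestRun_finite κ I b
  simp only [gain_eq_expect]
  rw [← expect_sum hf, ← expect_const hf (k : ℝ)]
  refine expect_mono hf fun r hr => ?_
  have h1 : ∑ i ∈ I, (b i * (P.items κ r i : ℝ) - P.pay κ r i) ≤ ∑ i ∈ I, (P.items κ r i : ℝ) := by
    refine Finset.sum_le_sum fun i hi => ?_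
    have hp : (0 : ℝ) ≤ P.pay κ r i := NNReal.coe_nonneg _
    have := mul_le_mul_of_nonneg_right (U.mem_unit κ _ (h.mem i hi)).2
      (Nat.cast_nonneg (α := ℝ) (P.items κ r i))
    linarith
  refine h1.trans ?_
  have h2 := P.sold_le_supply (κ := κ) r
  rw [(P.honestTrace h hr).sold_eq] at h2
  exact_mod_cast h2

/-! ### Incentive compatibility in terms of expected utilities -/

theorem ReplacementBIC.gain_update_le (hP : P.ReplacementBIC) (h : Admissible U Id κ I b)
    {i : Str} (hi : i ∈ I) {w : ℝ} (hw : w ∈ U.dom κ) :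
    P.gain κ I (Function.update b i w) (b i) i ≤ P.gain κ I b (b i) i := by
  have hsc : Scenario U Id κ (I.erase i) {i} {i} b := by
    refine ⟨fun j hj => h.carrier (Finset.mem_of_mem_erase hj), ?_, by simp, ?_, ?_, by simp⟩
    · simpa using h.carrier hi
    · intro j hj
      refine h.mem j ?_
      rcases Finset.mem_union.1 hj with hj | hj
      · exact Finset.mem_of_mem_erase hj
      · rwa [Finset.mem_singleton.1 hj]
    · exact fun j hj => Or.inl hj
  have key := hP (Polynomial.C (I.erase i).card) (fun _ => i) ⟨fun _ => {i}, fun _ _ => w⟩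
    (polySize_const _) κ (I.erase i) b hsc (by simp) fun _ _ => hw
  have hI : I.erase i ∪ {i} = I := by
    rw [Finset.union_comm, ← Finset.insert_eq, Finset.insert_erase hi]
  have hup : Admissible U Id κ I (Function.update b i w) := by
    refine ⟨h.carrier, fun j hj => ?_⟩
    by_cases hji : j = i
    · simpa [hji] using hw
    · simpa [hji] using h.mem j hj
  have hrun : P.replacedRun κ (I.erase i) {i} b (fun _ => w) =
      P.honestRun κ I (Function.update b i w) := by
    rw [Protocol.replacedRun, hI]
    refine P.honestRun_congr κ fun j hj => ?_
    by_cases hji : j = i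
    · simp [hji]
    · simp [hji, hj]
  rw [hrun, hI] at key
  simpa only [P.expect_utilBuyer hup hi, P.expect_utilBuyer h hi] using key

/-- What a coalition of the platform and the buyers in `C` gets if only those in `F` participate,
with other bids, is at most what it gets by being honest. -/
theorem ReplacementPBIC.surplus_add_gain_le {m : ℕ} (hP : P.ReplacementPBIC m)
    (h : Admissible U Id κ I b) {C F : Finset Str} (hC : C.Nonempty) (hCm : C.card ≤ m)
    (hCI : C ⊆ I) (hFC : F ⊆ C) (hb : ∀ i ∈ I \ C, b' i = b i) (hF : ∀ i ∈ F, b' i ∈ U.dom κ) :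
    P.surplus κ (I \ C ∪ F) b' + ∑ i ∈ F, P.gain κ (I \ C ∪ F) b' (b i) i ≤
      P.surplus κ I b + ∑ i ∈ C, P.gain κ I b (b i) i := by
  have hI : I \ C ∪ C = I := Finset.sdiff_union_of_subset hCI
  have hd : Disjoint (I \ C) F := Finset.disjoint_of_subset_right hFC Finset.sdiff_disjoint
  have hsc : Scenario U Id κ (I \ C) C F b := by
    refine ⟨fun j hj => h.carrier (Finset.sdiff_subset hj), fun j hj => h.carrier (hCI hj),
      Finset.sdiff_disjoint, ?_, fun j hj => Or.inl (hFC hj), hd⟩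
    rw [hI]
    exact h.mem
  have key := hP (Polynomial.C (I \ C).card) (fun _ => C) (fun _ => ⟨hC, hCm⟩)
    ⟨fun _ => F, fun _ => b'⟩ (polySize_const _) κ (I \ C) b hsc (by simp) hF
  have hrun : P.replacedRun κ (I \ C) F b b' = P.honestRun κ (I \ C ∪ F) b' := by
    refine P.honestRun_congr κ fun j hj => ?_
    by_cases hjC : j ∈ I \ C
    · rw [Finset.piecewise_eq_of_mem _ _ _ hjC, hb j hjC]
    · rw [Finset.piecewise_eq_of_notMem _ _ _ hjC]
  rw [hrun, hI] at key
  have hadm : Admissible U Id κ (I \ C ∪ F) b' := by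
    refine ⟨fun j hj => ?_, fun j hj => ?_⟩
    · rcases Finset.mem_union.1 hj with hj | hj
      exacts [h.carrier (Finset.sdiff_subset hj), h.carrier (hCI (hFC hj))]
    · rcases Finset.mem_union.1 hj with hj | hj
      exacts [hb j hj ▸ h.mem j (Finset.sdiff_subset hj), hF j hj]
  have hf := P.honestRun_finite κ I b
  have hf' := P.honestRun_finite κ (I \ C ∪ F) b'
  -- Payments of the members in `F` to the platform are internal to the coalition and cancel. What
  -- remains is the inequality `sum_mul_le_topSum`.
  have hl : P.surplus κ (I \ C ∪ F) b' + ∑ i ∈ F, P.gain κ (I \ C ∪ F) b' (b i) i ≤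
      expect (P.honestRun κ (I \ C ∪ F) b') (P.utilCoalition κ (I \ C) C b) := by
    simp only [gain_eq_expect, surplus]
    rw [← expect_sum hf', ← expect_add hf']
    refine expect_mono hf' fun r hr => ?_
    have ht := P.honestTrace hadm hr
    have hsafe : Protocol.Safe (I \ C) r :=
      ⟨ht.safe.1, fun i hi => ht.safe.2 i (Finset.mem_union_left _ hi)⟩
    have hsold : P.sold κ r - ∑ i ∈ I \ C, P.items κ r i = ∑ i ∈ F, P.items κ r i := by
      rw [ht.sold_eq, Finset.sum_union hd, Nat.add_sub_cancel_left]
    have htop := sum_mul_le_topSum hFC b (x := P.items κ r) fun i hi =>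
      ht.items_le i (Finset.mem_union_right _ hi)
    rw [Protocol.utilCoalition, if_pos hsafe, hsold, Finset.sum_union hd,
      Finset.sum_sub_distrib]
    linarith
  have hr : expect (P.honestRun κ I b) (P.utilHonestCoalition κ (I \ C) C b) =
      P.surplus κ I b + ∑ i ∈ C, P.gain κ I b (b i) i := by
    simp only [gain_eq_expect, surplus]
    rw [← expect_sum hf, ← expect_add hf]
    refine expect_congr fun r hr => ?_
    have ht := P.honestTrace h hr
    rw [Protocol.utilHonestCoalition, Protocol.utilPlatform, if_pos ht.acc, hI]
    congr 1
    exact Finset.sum_congr rfl fun i hi => ht.utilBuyer_eq (hCI hi) _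
  exact hl.trans (key.trans_eq hr)

end Auction

/-! ### Auxiliary facts on distributions, sorted lists and negligible functions -/

theorem bind_eq_of_forall_mem_support {α β : Type} {μ : PMF α} {f : α → PMF β} {ν : PMF β}
    (h : ∀ a ∈ μ.support, f a = ν) : μ.bind f = ν := by
  rw [← PMF.bind_const μ ν]
  ext y
  simp only [PMF.bind_apply]
  refine tsum_congr fun a => ?_
  by_cases ha : a ∈ μ.support
  · rw [h a ha]
  · have : μ a = 0 := by simpa [PMF.mem_support_iff] using ha
    simp [this]

/-- A list without duplicates sorted by decreasing value starts with the only element of positive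
value. -/
theorem exists_eq_cons_of_pairwise {l : List Str} {c : Str} {v : ℝ} (hv : 0 < v) (hl : l.Nodup)
    (hc : c ∈ l)
    (hs : l.Pairwise fun i j => (Pi.single c v : Str → ℝ) j ≤ (Pi.single c v : Str → ℝ) i) :
    ∃ t, l = c :: t ∧
      l.map (Pi.single c v : Str → ℝ) = v :: List.replicate (l.length - 1) 0 := by
  cases l with
  | nil => simp at hc
  | cons a t =>
    have hac : a = c := by
      by_contra hne
      have hct : c ∈ t := by
        rcases List.mem_cons.1 hc with rfl | h
        exacts [absurd rfl hne, h]
      have := (List.pairwise_cons.1 hs).1 c hct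
      simp only [Pi.single_eq_same, Pi.single_eq_of_ne hne] at this
      exact absurd this (not_le.2 hv)
    subst hac
    refine ⟨t, rfl, ?_⟩
    rw [List.map_cons, Pi.single_eq_same, List.length_cons, Nat.add_sub_cancel]
    congr 1
    rw [List.eq_replicate_iff]
    refine ⟨by simp, fun x hx => ?_⟩
    obtain ⟨j, hj, rfl⟩ := List.mem_map.1 hx
    have hja : j ≠ a := fun hja => (List.nodup_cons.1 hl).1 (hja ▸ hj)
    simp [hja]

theorem Negligible.eventually_mul_lt_one {ε : ℕ → ℝ} (h : Negligible ε) (p : Polynomial ℕ) :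
    ∀ᶠ κ : ℕ in atTop, ((p.eval κ : ℕ) : ℝ) * ε κ < 1 := by
  have h1 := (h.2.polynomial_mul (p.map (Nat.castRingHom ℝ))) 0
  filter_upwards [h1.eventually_lt_const one_pos] with κ hκ
  simpa using hκ

namespace Auction

variable {k : ℕ} {U : ValueDomain} {Id : IdentitySpace} {P : Auction k U Id} {κ : ℕ}
  {I J : Finset Str} {b b' : Str → ℝ}

theorem Admissible.update (h : Admissible U Id κ I b) (d : Str) {w : ℝ} (hw : w ∈ U.dom κ) :
    Admissible U Id κ I (Function.update b d w) := by
  refine ⟨h.carrier, fun j hj => ?_⟩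
  by_cases hjd : j = d
  · simpa [hjd] using hw
  · simpa [hjd] using h.mem j hj

theorem Admissible.piecewise (h : Admissible U Id κ I b) (h' : Admissible U Id κ I b')
    (S : Finset Str) : Admissible U Id κ I (S.piecewise b b') := by
  refine ⟨h.carrier, fun j hj => ?_⟩
  by_cases hjS : j ∈ S
  · simpa [hjS] using h.mem j hj
  · simpa [hjS] using h'.mem j hj

theorem admissible_zero (hI : (I : Set Str) ⊆ Id.carrier κ) : Admissible U Id κ I 0 :=
  ⟨hI, fun _ _ => U.zero_mem κ⟩

theorem admissible_single (hI : (I : Set Str) ⊆ Id.carrier κ) (c : Str) {v : ℝ}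
    (hv : v ∈ U.dom κ) : Admissible U Id κ I (Pi.single c v) :=
  (admissible_zero hI).update c hv

/-! ### Almost independence of the bids of others -/

/-- The joint utility of the platform and the partners of `d` in a coalition hardly depends on the
bid of `d`. -/
theorem abs_coalition_sub_le (hB : P.ReplacementBIC) {m : ℕ} (hC : P.ReplacementPBIC m)
    (h : Admissible U Id κ I b) {C : Finset Str} (hCI : C ⊆ I) (hCm : C.card ≤ m) {d : Str}
    (hd : d ∈ C) {w : ℝ} (hw : w ∈ U.dom κ) :
    |(P.surplus κ I (Function.update b d w) +
        ∑ i ∈ C.erase d, P.gain κ I (Function.update b d w) (b i) i) -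
      (P.surplus κ I b + ∑ i ∈ C.erase d, P.gain κ I b (b i) i)| ≤ tick (U.dom κ) := by
  -- Both rules accompany the allocation of `d`: `h` is truthful by bIC and `g` by pbIC. Their
  -- difference `g - h` is the quantity to be controlled.
  have key := abs_sub_le_tick (U := U.dom κ)
    (x := fun w => P.meanItems κ I (Function.update b d w) d)
    (g := fun w => (P.surplus κ I (Function.update b d w) +
      ∑ i ∈ C.erase d, P.gain κ I (Function.update b d w) (b i) i) -
        P.meanPay κ I (Function.update b d w) d)
    (h := fun w => - P.meanPay κ I (Function.update b d w) d) ?_ ?_ ?_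
    (h.mem d (hCI hd)) hw
  · simpa using key
  · exact fun w hw => P.meanItems_mem (h.update d hw) (hCI hd)
  · intro v hv w hw
    have h1 := hC.surplus_add_gain_le P (h.update d hv) (b' := Function.update b d w)
      ⟨d, hd⟩ hCm hCI subset_rfl ?_ ?_
    · rw [Finset.sdiff_union_of_subset hCI, ← Finset.add_sum_erase C _ hd,
        ← Finset.add_sum_erase C _ hd, Function.update_self] at h1
      have h2 : ∀ y, ∑ i ∈ C.erase d,
          P.gain κ I (Function.update b d y) (Function.update b d v i) i =
          ∑ i ∈ C.erase d, P.gain κ I (Function.update b d y) (b i) i := fun y =>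
        Finset.sum_congr rfl fun i hi => by
          rw [Function.update_of_ne (Finset.ne_of_mem_erase hi)]
      rw [h2, h2] at h1
      simp only [gain] at h1 ⊢
      linarith
    · intro i hi
      have hid : i ≠ d := fun hid => (Finset.mem_sdiff.1 hi).2 (hid ▸ hd)
      rw [Function.update_of_ne hid, Function.update_of_ne hid]
    · exact fun i hi => (h.update d hw).mem i (hCI hi)
  · intro v hv w hw
    have h1 := hB.gain_update_le P (h.update d hv) (hCI hd) hw
    rw [Function.update_idem, Function.update_self] at h1
    simp only [gain] at h1
    linarith

/-- At the zero profile individual rationality forbids payments, so the surplus is not positive.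
Turning on the bids one by one changes it by at most a tick each, by the coalition of the platform
with that single buyer. -/
theorem surplus_le (hB : P.ReplacementBIC) (hC : P.ReplacementPBIC 2)
    (h : Admissible U Id κ I b) : P.surplus κ I b ≤ I.card * tick (U.dom κ) := by
  have key : ∀ S : Finset Str, S ⊆ I →
      P.surplus κ I (S.piecewise b 0) ≤ S.card * tick (U.dom κ) := by
    intro S
    induction S using Finset.induction_on with
    | empty =>
      intro _
      simpa using P.surplus_zero_le (admissible_zero h.carrier) fun _ _ => rfl
    | insert d S hdS ih =>
      intro hS
      have hd := hS (Finset.mem_insert_self d S)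
      have h1 := abs_coalition_sub_le hB hC (h.piecewise (admissible_zero h.carrier) S)
        (Finset.singleton_subset_iff.2 hd) (by simp) (Finset.mem_singleton_self d) (h.mem d hd)
      rw [Finset.piecewise_insert, Finset.card_insert_of_notMem hdS]
      have h2 := ih ((Finset.subset_insert d S).trans hS)
      simp only [Finset.erase_singleton, Finset.sum_empty, add_zero] at h1
      have h3 := (abs_le.1 h1).2
      push_cast
      linarith
  have := key I subset_rfl
  rwa [P.surplus_congr (b := I.piecewise b 0) (b' := b)
    fun i hi => Finset.piecewise_eq_of_mem _ _ _ hi] at this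

/-- In the coalition with `d` and `c`, surplus plus the utility of `c` moves by at most one tick.
The surplus itself lies between `0` and `I.card` ticks, whence the factor `I.card + 1`. -/
theorem gain_le_gain_update_add (hB : P.ReplacementBIC) (hC : P.ReplacementPBIC 2)
    (h : Admissible U Id κ I b) {c d : Str} (hc : c ∈ I) (hd : d ∈ I) (hcd : c ≠ d) {w : ℝ}
    (hw : w ∈ U.dom κ) :
    P.gain κ I b (b c) c ≤
      P.gain κ I (Function.update b d w) (b c) c + (I.card + 1) * tick (U.dom κ) := by
  have h1 := abs_coalition_sub_le hB hC h (C := {d, c})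
    (by simp [Finset.insert_subset_iff, hc, hd]) Finset.card_le_two
    (Finset.mem_insert_self d {c}) hw
  rw [Finset.erase_insert (by simpa using hcd.symm), Finset.sum_singleton,
    Finset.sum_singleton] at h1
  have h2 := (abs_le.1 h1).1
  have h3 := surplus_le hB hC (h.update d hw)
  have h4 := P.surplus_nonneg h
  linarith

/-- The utility of a buyer hardly depends on the bids of the others. -/
theorem gain_le_gain_add (hB : P.ReplacementBIC) (hC : P.ReplacementPBIC 2)
    (h : Admissible U Id κ I b) (h' : Admissible U Id κ I b') {c : Str} (hc : c ∈ I)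
    (hbc : b' c = b c) :
    P.gain κ I b (b c) c ≤
      P.gain κ I b' (b c) c + I.card * (I.card + 1) * tick (U.dom κ) := by
  have hτ := U.tick_nonneg κ
  have hbS : ∀ S : Finset Str, S.piecewise b' b c = b c := fun S => by
    by_cases hcS : c ∈ S
    · simp [hcS, hbc]
    · simp [hcS]
  -- Hybrid argument: bids on `S` are already replaced by those of `b'`. The step at `c` itself
  -- changes nothing because `b' c = b c`.
  have key : ∀ S : Finset Str, S ⊆ I → P.gain κ I b (b c) c ≤
      P.gain κ I (S.piecewise b' b) (b c) c + S.card * ((I.card + 1) * tick (U.dom κ)) := by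
    intro S
    induction S using Finset.induction_on with
    | empty => simp
    | insert d S hdS ih =>
      intro hS
      have hd := hS (Finset.mem_insert_self d S)
      have h1 := ih ((Finset.subset_insert d S).trans hS)
      have h2 : P.gain κ I (S.piecewise b' b) (b c) c ≤
          P.gain κ I ((insert d S).piecewise b' b) (b c) c +
            (I.card + 1) * tick (U.dom κ) := by
        rw [Finset.piecewise_insert]
        by_cases hcd : c = d
        · subst hcd
          rw [hbc, Function.update_eq_self_iff.2 (hbS S).symm]
          exact le_add_of_nonneg_right (by positivity)
        · have := gain_le_gain_update_add hB hC (h'.piecewise h S) hc hd hcd (h'.mem d hd)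
          rwa [hbS] at this
      rw [Finset.card_insert_of_notMem hdS]
      push_cast
      linarith
  have := key I subset_rfl
  rwa [P.gain_congr (b := I.piecewise b' b) (b' := b')
    fun i hi => Finset.piecewise_eq_of_mem _ _ _ hi, ← mul_assoc] at this

/-! ### Additional buyers with value zero -/

/-- The coalition of the platform with `c` and `f` may leave `f` out. The loss from including `f` is
bounded by the surplus, since `f` has value zero and hence no positive utility, and the surplus
without `f` is nonnegative. -/
theorem gain_le_gain_insert_add (hB : P.ReplacementBIC) (hC : P.ReplacementPBIC 2) {f : Str}
    (h : Admissible U Id κ (insert f I) b) (hf : f ∉ I) (hbf : b f = 0) {c : Str} (hc : c ∈ I) :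
    P.gain κ I b (b c) c ≤
      P.gain κ (insert f I) b (b c) c + (insert f I).card * tick (U.dom κ) := by
  have hcf : c ≠ f := fun hcf => hf (hcf ▸ hc)
  have hsub : ({c, f} : Finset Str) ⊆ insert f I := by
    simp [Finset.insert_subset_iff, hc]
  have h1 := hC.surplus_add_gain_le P h (b' := b) (F := {c}) (Finset.insert_nonempty c {f})
    Finset.card_le_two hsub (by simp) (fun _ _ => rfl)
    (fun i hi => h.mem i (by rw [Finset.mem_singleton.1 hi]; simp [hc]))
  have hI : insert f I \ {c, f} ∪ {c} = I := by
    ext j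
    by_cases hjc : j = c
    · simp [hjc, hc]
    · by_cases hjf : j = f
      · simp [hjf, hf, hcf.symm]
      · simp [hjc, hjf]
  have hI' : Admissible U Id κ I b :=
    ⟨fun j hj => h.carrier (Finset.mem_insert_of_mem hj),
      fun j hj => h.mem j (Finset.mem_insert_of_mem hj)⟩
  rw [hI, Finset.sum_singleton, Finset.sum_pair hcf, hbf] at h1
  have h2 := surplus_le hB hC h
  have h3 := P.surplus_nonneg hI'
  have h4 := P.gain_zero_nonpos κ (insert f I) b f
  linarith

theorem gain_le_gain_of_subset (hB : P.ReplacementBIC) (hC : P.ReplacementPBIC 2)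
    (h : Admissible U Id κ J b) (hIJ : I ⊆ J) (hb : ∀ i ∈ J \ I, b i = 0) {c : Str} (hc : c ∈ I) :
    P.gain κ I b (b c) c ≤ P.gain κ J b (b c) c + J.card * J.card * tick (U.dom κ) := by
  have hτ := U.tick_nonneg κ
  have key : ∀ S : Finset Str, S ⊆ J \ I → P.gain κ I b (b c) c ≤
      P.gain κ (I ∪ S) b (b c) c + S.card * (J.card * tick (U.dom κ)) := by
    intro S
    induction S using Finset.induction_on with
    | empty => simp
    | insert f S hfS ih =>
      intro hS
      have hf := Finset.mem_sdiff.1 (hS (Finset.mem_insert_self f S))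
      have hsub : insert f (I ∪ S) ⊆ J := by
        rw [← Finset.union_insert]
        exact Finset.union_subset hIJ (hS.trans Finset.sdiff_subset)
      have h1 := ih ((Finset.subset_insert f S).trans hS)
      have h2 := gain_le_gain_insert_add hB hC (I := I ∪ S) (f := f) (b := b)
        ⟨fun j hj => h.carrier (hsub hj), fun j hj => h.mem j (hsub hj)⟩ (by simp [hf.2, hfS])
        (hb f (hS (Finset.mem_insert_self f S))) (Finset.mem_union_left S hc)
      have h3 : ((insert f (I ∪ S)).card : ℝ) * tick (U.dom κ) ≤ J.card * tick (U.dom κ) :=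
        mul_le_mul_of_nonneg_right (mod_cast Finset.card_le_card hsub) hτ
      rw [Finset.card_insert_of_notMem hfS, Finset.union_insert]
      push_cast
      linarith
  have h1 := key (J \ I) subset_rfl
  rw [Finset.union_sdiff_of_subset hIJ] at h1
  have h2 : ((J \ I).card : ℝ) * (J.card * tick (U.dom κ)) ≤
      J.card * (J.card * tick (U.dom κ)) :=
    mul_le_mul_of_nonneg_right (mod_cast Finset.card_le_card Finset.sdiff_subset) (by positivity)
  rw [mul_assoc]
  linarith

/-! ### Symmetry -/

/-- The outcome of the only buyer with a positive bid does not depend on its identity. -/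
theorem exists_map_outcome_eq (P : Auction k U Id) (hI : (I : Set Str) ⊆ Id.carrier κ) {v : ℝ}
    (hv : v ∈ U.dom κ) (hv0 : 0 < v) :
    ∃ μ : PMF (ℕ × ℝ≥0), ∀ c ∈ I, (P.honestRun κ I (Pi.single c v)).map
      (fun r => (P.items κ r c, P.pay κ r c)) = μ := by
  obtain ⟨sortRule, alg, H⟩ := P.weaklySymmetric κ
  refine ⟨(alg (v :: List.replicate (I.card - 1) 0)).map fun o => o.1.getD 0 (0, 0),
    fun c hc => ?_⟩
  have hadm := admissible_single (U := U) hI c hv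
  obtain ⟨hsort, heq⟩ := H I (Pi.single c v) hI hadm.mem
  have h1 : (P.honestRun κ I (Pi.single c v)).map (fun r => (P.items κ r c, P.pay κ r c)) =
      ((P.honestRun κ I (Pi.single c v)).map (P.outcome κ I)).map fun o => o.1 c := by
    rw [PMF.map_comp]
    congr 1
    funext r
    simp [Protocol.outcome, hc]
  rw [h1, heq, PMF.map_bind]
  -- However ties are broken, `c` comes first and the sorted value vector is the same. The law of
  -- its outcome thus depends neither on `l` nor on `c`.
  refine bind_eq_of_forall_mem_support fun l hl => ?_
  obtain ⟨hnd, hlI, hpw⟩ := hsort l hl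
  have hcl : c ∈ l := by
    rw [← List.mem_toFinset, hlI]
    exact hc
  obtain ⟨t, rfl, ht⟩ := exists_eq_cons_of_pairwise hv0 hnd hcl hpw
  rw [ht, PMF.map_comp, ← List.toFinset_card_of_nodup hnd, hlI]
  congr 1
  funext o
  simp

/-- Positivity of `v` matters: a zero bid would tie with the others, and tie-breaking may depend on
identities. -/
theorem gain_single_eq (P : Auction k U Id) (hI : (I : Set Str) ⊆ Id.carrier κ) {v : ℝ}
    (hv : v ∈ U.dom κ) (hv0 : 0 < v) {c i : Str} (hc : c ∈ I) (hi : i ∈ I) :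
    P.gain κ I (Pi.single c v) v c = P.gain κ I (Pi.single i v) v i := by
  obtain ⟨μ, hμ⟩ := P.exists_map_outcome_eq hI hv hv0
  have key : ∀ j ∈ I, P.gain κ I (Pi.single j v) v j =
      expect μ fun z => v * (z.1 : ℝ) - z.2 := by
    intro j hj
    rw [gain_eq_expect, ← hμ j hj, expect_map (P.honestRun_finite _ _ _)]
  rw [key c hc, key i hi]

/-! ### The impossibility -/

/-- If all of `J` have the value of `c`, each of them gets the utility of `c` up to the error term,
and these utilities add up to at most `k`. -/
theorem card_mul_gain_sub_le (hB : P.ReplacementBIC) (hC : P.ReplacementPBIC 2)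
    (h : Admissible U Id κ I b) (hIJ : I ⊆ J) (hJ : (J : Set Str) ⊆ Id.carrier κ) {c : Str}
    (hc : c ∈ I) :
    J.card * (P.gain κ I b (b c) c - 3 * (J.card * (J.card + 1)) * tick (U.dom κ)) ≤ k := by
  have hτ := U.tick_nonneg κ
  have hv := h.mem c hc
  have hcard : (I.card : ℝ) ≤ J.card := mod_cast Finset.card_le_card hIJ
  rcases (U.mem_unit κ _ hv).1.eq_or_lt with hv0 | hv0
  · refine le_trans (mul_nonpos_of_nonneg_of_nonpos (Nat.cast_nonneg _) ?_) (Nat.cast_nonneg k)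
    have := P.gain_zero_nonpos κ I b c
    rw [← hv0]
    have : 0 ≤ 3 * ((J.card : ℝ) * (J.card + 1)) * tick (U.dom κ) := by positivity
    linarith
  set v := b c
  have hconst : Admissible U Id κ J fun _ => v := ⟨hJ, fun _ _ => hv⟩
  -- Pass from `b` on `I` to the lone bid of `c` on `I`, then on `J`, then to the lone bid of `i`,
  -- and finally to the constant profile. The change of identity is free and the other three moves
  -- cost at most `J.card * (J.card + 1)` ticks each.
  have key : ∀ i ∈ J, P.gain κ I b v c - 3 * (J.card * (J.card + 1)) * tick (U.dom κ) ≤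
      P.gain κ J (fun _ => v) v i := by
    intro i hi
    have h1 := gain_le_gain_add hB hC h (admissible_single h.carrier c hv) hc (by simp [v])
    have hzero : ∀ j ∈ J \ I, (Pi.single c v : Str → ℝ) j = 0 := by
      intro j hj
      have hjc : j ≠ c := fun hjc => (Finset.mem_sdiff.1 hj).2 (hjc ▸ hc)
      simp [hjc]
    have h2 := gain_le_gain_of_subset hB hC (admissible_single hJ c hv) hIJ hzero hc
    have h3 := P.gain_single_eq hJ hv hv0 (hIJ hc) hi
    have h4 := gain_le_gain_add hB hC (admissible_single hJ i hv) hconst hi (by simp)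
    simp only [Pi.single_eq_same] at h2 h4
    have h5 : (I.card : ℝ) * (I.card + 1) * tick (U.dom κ) ≤
        J.card * (J.card + 1) * tick (U.dom κ) := by gcongr
    have h6 : (J.card : ℝ) * J.card * tick (U.dom κ) ≤
        J.card * (J.card + 1) * tick (U.dom κ) := by
      gcongr
      linarith
    linarith
  have h1 := Finset.card_nsmul_le_sum J _ _ key
  rw [nsmul_eq_mul] at h1
  exact h1.trans (P.sum_gain_le hconst)

/-- With many identities at hand, the total utility of the buyers is small. -/
theorem card_mul_sum_gain_sub_le (hB : P.ReplacementBIC) (hC : P.ReplacementPBIC 2)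
    (h : Admissible U Id κ I b) (hIJ : I ⊆ J) (hJ : (J : Set Str) ⊆ Id.carrier κ) :
    J.card * (∑ i ∈ I, P.gain κ I b (b i) i -
      I.card * (3 * (J.card * (J.card + 1)) * tick (U.dom κ))) ≤ I.card * k := by
  have h1 := Finset.sum_le_card_nsmul I _ _ fun c hc => card_mul_gain_sub_le hB hC h hIJ hJ hc
  rwa [← Finset.mul_sum, Finset.sum_sub_distrib, Finset.sum_const, nsmul_eq_mul,
    nsmul_eq_mul] at h1

theorem expect_sum_utilBuyer (h : Admissible U Id κ I b) :
    expect (P.honestRun κ I b) (fun r => ∑ i ∈ I, P.utilBuyer κ {i} (b i) r) =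
      ∑ i ∈ I, P.gain κ I b (b i) i := by
  rw [expect_sum (P.honestRun_finite κ I b)]
  exact Finset.sum_congr rfl fun i hi => P.expect_utilBuyer h hi (b i)

end Auction

end PlatformAuction

end

/-! ### Choice of the parameters -/

theorem mainTheorem6 (k : ℕ) (U : PlatformAuction.ValueDomain)
    (Id : PlatformAuction.IdentitySpace) (P : PlatformAuction.Auction k U Id)
    (hnt : P.NonTrivial)
    (htick : ∃ ε : ℕ → ℝ, PlatformAuction.Negligible ε ∧
      ∀ᶠ κ in Filter.atTop, PlatformAuction.tick (U.dom κ) ≤ ε κ) :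
    ¬ (P.StrongCompBIC ∧ P.StrongCompPBIC 2) := by
  rintro ⟨⟨-, hB⟩, -, hC⟩
  obtain ⟨q, hq, hfreq⟩ := hnt
  obtain ⟨ε, hε, hle⟩ := htick
  -- `M` is the number of extra identities, and `L` bounds the size of `I ∪ T`. With utility at
  -- least `1 / q` and total error at most half of that, the final bound reads `j / 2 ≤ q ^ 2 * k`,
  -- which `j ≥ 2 * (k + 1) * q ^ 2` contradicts.
  let M : Polynomial ℕ := Polynomial.C (2 * (k + 1)) * q ^ 2
  let L : Polynomial ℕ := q + M
  -- The total error is at most `q * 3 * (L * (L + 1))` ticks. The factor `6 * q ^ 2` brings it down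
  -- to `1 / (2 * q)`.
  have hsmall := hε.eventually_mul_lt_one (Polynomial.C 6 * q ^ 2 * (L * (L + 1)))
  obtain ⟨κ, ⟨I, b, hI, hb, hIq, hutil⟩, hτε, hsm, hfake⟩ :=
    (hfreq.and_eventually (hle.and (hsmall.and (Id.superpoly M)))).exists
  have hadm : PlatformAuction.Auction.Admissible U Id κ I b := ⟨hI, hb⟩
  obtain ⟨T, hTsub, hTcard⟩ := Set.exists_subset_encard_eq hfake
  have hTfin : T.Finite := Set.finite_of_encard_eq_coe hTcard
  lift T to Finset PlatformAuction.Str using hTfin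
  rw [Set.encard_coe_eq_coe_finsetCard, Nat.cast_inj] at hTcard
  have hJ : ((I ∪ T : Finset PlatformAuction.Str) : Set PlatformAuction.Str) ⊆ Id.carrier κ := by
    rw [Finset.coe_union]
    exact Set.union_subset hI (hTsub.trans (Id.fake_subset κ))
  have key := PlatformAuction.Auction.card_mul_sum_gain_sub_le hB hC hadm Finset.subset_union_left hJ
  rw [PlatformAuction.Auction.expect_sum_utilBuyer hadm] at hutil
  have hJL : (I ∪ T).card ≤ L.eval κ := by
    refine (Finset.card_union_le I T).trans ?_
    simp only [L, Polynomial.eval_add]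
    omega
  have hJM : 2 * (k + 1) * (q.eval κ) ^ 2 ≤ (I ∪ T).card := by
    have h1 : M.eval κ = 2 * (k + 1) * (q.eval κ) ^ 2 := by simp [M]
    rw [← h1, ← hTcard]
    exact Finset.card_le_card Finset.subset_union_right
  have hτ := U.tick_nonneg κ
  have hq1 := hq κ
  simp only [Polynomial.eval_mul, Polynomial.eval_add, Polynomial.eval_pow, Polynomial.eval_C,
    Polynomial.eval_one] at hsm
  generalize PlatformAuction.tick (U.dom κ) = τ at *
  generalize q.eval κ = Q at *
  generalize L.eval κ = l at *
  generalize (I ∪ T).card = j at *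
  generalize I.card = n at *
  generalize ∑ i ∈ I, P.gain κ I b (b i) i = s at *
  have hQ : (0 : ℝ) < Q := mod_cast hq1
  have hn : (n : ℝ) ≤ Q := mod_cast hIq
  have hj : (j : ℝ) ≤ l := mod_cast hJL
  have hjM : 2 * ((k : ℝ) + 1) * (Q : ℝ) ^ 2 ≤ j := mod_cast hJM
  have hs : 1 ≤ Q * s := by
    rw [div_le_iff₀ hQ] at hutil
    linarith
  push_cast at hsm
  have herr : 6 * (Q : ℝ) ^ 2 * (j * (j + 1)) * τ ≤ 1 := by
    refine le_trans ?_ hsm.le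
    gcongr
  have herr' : Q * (n * (3 * (j * (j + 1)) * τ)) ≤ 1 / 2 := by
    have : Q * (n * (3 * (j * (j + 1)) * τ)) ≤
        Q * (Q * (3 * (j * (j + 1)) * τ)) := by gcongr
    linarith
  have h1 : (j : ℝ) * (1 / 2) ≤
      j * (Q * s - Q * (n * (3 * (j * (j + 1)) * τ))) := by
    gcongr
    linarith
  have h2 : Q * ((n : ℝ) * k) ≤ Q * (Q * k) := by gcongr
  have h3 := mul_le_mul_of_nonneg_left key hQ.le
  have hQ2 : 0 < (Q : ℝ) ^ 2 := by positivity
  linarith
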